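/- Let $K$ be a field and let $q,a\in K$ be such that $q^m\neq 1$ for all integers $m\ge 1$ and $a\neq -1$ (for example, $q$ and $a$ independent indeterminates). Write $(x;p)_n=\prod_{i=0}^{n-1}(1-xp^i)$ and $\left[{n\atop k}\right]_q=\frac{(q;q)_n}{(q;q)_k\,(q;q)_{n-k}}$, and for $n\ge 0$ put $$P_n(a)=\frac{1}{(q;q^2)_{\lfloor (n+1)/2\rfloor}}\sum_{k=0}^n\left[{n\atop k}\right]_q a^k .$$ For $n\ge 1$ let $$\lambda_n=\frac{q^n(1+a)^2(1-q^{n-1})(1-q^n)}{(1-q^{2n-1})^2}\quad (n\text{ even}),$$ $$\lambda_n=-\frac{(a+q^n)(a+q^{n-1})(1+aq^{n-1})(1+aq^n)}{(1+a)^2(1-q^{2n-1})^2}\quad (n\text{ odd}).$$ Then for every integer $n\ge 0$ $$\det\bigl(P_{i+j}(a)\bigr)_{0\le i,j\le n}=\prod_{i=1}^{n}\lambda_i^{\,n+1-i}.$$ -/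

import Mathlib

namespace QHermiteMoments

/-- The `q`-shifted factorial `(x; p)_n = ∏_{i=0}^{n-1} (1 - x p^i)`. -/
def qPoch {K : Type*} [Field K] (x p : K) (n : ℕ) : K :=
  ∏ i ∈ Finset.range n, (1 - x * p ^ i)

/-- The `q`-binomial coefficient `(q; q)_n / ((q; q)_k (q; q)_{n-k})`, used for `0 ≤ k ≤ n`. -/
def qBinom {K : Type*} [Field K] (q : K) (n k : ℕ) : K :=
  qPoch q q n / (qPoch q q k * qPoch q q (n - k))

/-- The moment
`P_n(a) = (1 / (q; q^2)_{⌊(n+1)/2⌋}) ∑_{k=0}^n [n choose k]_q a^k`. -/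
def P {K : Type*} [Field K] (q a : K) (n : ℕ) : K :=
  1 / qPoch q (q ^ 2) ((n + 1) / 2) * ∑ k ∈ Finset.range (n + 1), qBinom q n k * a ^ k

/-- The coefficient `λ_n`, `n ≥ 1`, of the three-term recurrence
`s_{n+1}(x) = (x - b_n) s_n(x) - λ_n s_{n-1}(x)`. The value at `n = 0` is never used, so the
subtractions `n - 1` and `2 * n - 1` below are the usual ones. -/
def recLambda {K : Type*} [Field K] (q a : K) (n : ℕ) : K :=
  if Even n then
    q ^ n * (1 + a) ^ 2 * (1 - q ^ (n - 1)) * (1 - q ^ n) / (1 - q ^ (2 * n - 1)) ^ 2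
  else
    -((a + q ^ n) * (a + q ^ (n - 1)) * (1 + a * q ^ (n - 1)) * (1 + a * q ^ n) /
      ((1 + a) ^ 2 * (1 - q ^ (2 * n - 1)) ^ 2))

end QHermiteMoments

/-!
Let `p = q ^ 2` and let `L` be the linear functional on `K[X]` with `L(X ^ n) = P_n(a)`. A change
from the monomials to two bases of `K[X]`, adapted to degree, multiplies a Hankel determinant by the
leading coefficients (`det_gram_eq`). The proof chooses bases in which the Gram matrix of `L` is, up
to row and column factors, the Hankel matrix of the case `a = 0`, and then evaluates that case.

*Reduction to `a = 0`.* The three-term recurrence of the Rogers–Szegő polynomials says two things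
about `L`. With `w = (X - 1) (X - a)`, the functional `L` vanishes on `w f(X²)`
(`momentP_mul_expand`), and its even part `M(f) = L(f(X²))` satisfies the `q`-difference equation
`M((y - 1) (y - a²) f(y)) = p M((a + y) (a + q y) f(p y))` (`momentPEven_pearson`). For the products
`u_j = ∏_{i<j} (a + p^i y)` and `v_k = ∏_{i<k} (a + q p^i y)`, the second fact gives
`M(u_j v_k) = α_j β_k / (q; p)_{j+k}` with explicit products `α_j`, `β_k`
(`momentPEven_linProd_mul_linProd`). It also gives
`L(w² (u_j v_k)(X²)) = -p M(u_{j+1} v_{k+1})`. The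
polynomials `u_j(X²)` and `u_{j+1}(X²) - p^j w u_j(X²)` have degrees `2j` and `2j + 1`, likewise for
`v` with `q p^k` in place of `p^j`, and in these two bases all four parity cases of the Gram matrix
combine into `α_⌈r/2⌉ β_⌈s/2⌉ / (q; p)_⌈(r+s)/2⌉` (`momentP_gramBasis_mul_gramBasis`).

*The case `a = 0`.* The Hankel matrix of `1 / (c; p)_⌈n/2⌉` is handled for all `c` at once: column
operations clear its first two rows and leave, up to row and column factors, the same matrix with
`c p ^ 2` in place of `c` (`det_invPoch`).

The leading coefficients contain powers of `q`, so `q = 0` is treated separately. There the moments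
satisfy a linear recurrence of order two, and both sides vanish from size three on (`det_P_zero`).
-/

open Polynomial Finset

namespace QHermiteMoments

variable {K : Type*} [Field K]

/-! ### Moment functionals and Hankel determinants -/

/-- The linear functional on `K[X]` with moments `m n`, that is, with `X ^ n ↦ m n`. -/
noncomputable def momentFunctional (m : ℕ → K) : K[X] →ₗ[K] K :=
  Polynomial.lsum fun n => LinearMap.toSpanSingleton K K (m n)

@[simp]
lemma momentFunctional_X_pow (m : ℕ → K) (n : ℕ) : momentFunctional m (X ^ n) = m n := by
  simp [momentFunctional, Polynomial.lsum_apply, ← Polynomial.monomial_one_right_eq_X_pow]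

/-- Scalars written as constant polynomials pull out of a linear functional on `K[X]`. -/
lemma map_C_mul (L : K[X] →ₗ[K] K) (c : K) (f : K[X]) : L (C c * f) = c * L f := by
  rw [← smul_eq_C_mul, map_smul, smul_eq_mul]

lemma sum_coeff_mul_X_pow_fin {f : K[X]} {n N : ℕ} (hf : f.natDegree ≤ n) (hn : n < N) :
    f = ∑ i : Fin N, C (f.coeff i) * X ^ (i : ℕ) := by
  rw [Fin.sum_univ_eq_sum_range (fun i => C (f.coeff i) * X ^ i) N]
  exact f.as_sum_range_C_mul_X_pow' (by omega)

/-- Replacing the monomials by two bases of polynomials with `e r`, `f r` of degree `r` multiplies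
a Hankel determinant by the product of the leading coefficients. -/
lemma det_gram_eq (L : K[X] →ₗ[K] K) (e f : ℕ → K[X])
    (he : ∀ r, (e r).natDegree ≤ r) (hf : ∀ r, (f r).natDegree ≤ r) (N : ℕ) :
    Matrix.det (Matrix.of fun r s : Fin N => L (e r * f s)) =
      (∏ r ∈ range N, ((e r).coeff r * (f r).coeff r)) *
        Matrix.det (Matrix.of fun r s : Fin N => L (X ^ ((r : ℕ) + s))) := by
  let E : Matrix (Fin N) (Fin N) K := Matrix.of fun r i => (e r).coeff i
  let F : Matrix (Fin N) (Fin N) K := Matrix.of fun s i => (f s).coeff i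
  let H : Matrix (Fin N) (Fin N) K := Matrix.of fun r s => L (X ^ ((r : ℕ) + s))
  have hE : E.det = ∏ r : Fin N, (e r).coeff r :=
    Matrix.det_of_isLowerTriangular E fun i j hij =>
      coeff_eq_zero_of_natDegree_lt ((he i).trans_lt (by simpa using hij))
  have hF : F.det = ∏ r : Fin N, (f r).coeff r :=
    Matrix.det_of_isLowerTriangular F fun i j hij =>
      coeff_eq_zero_of_natDegree_lt ((hf i).trans_lt (by simpa using hij))
  have hG : (Matrix.of fun r s : Fin N => L (e r * f s)) = E * H * F.transpose := by
    ext r s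
    simp only [Matrix.of_apply, Matrix.mul_apply, Matrix.transpose_apply, E, F, H]
    conv_lhs =>
      rw [sum_coeff_mul_X_pow_fin (he r) r.2, sum_coeff_mul_X_pow_fin (hf s) s.2]
    rw [sum_mul_sum, map_sum, Finset.sum_congr rfl fun i _ => map_sum L _ _, sum_comm]
    refine sum_congr rfl fun j _ => ?_
    rw [sum_mul]
    refine sum_congr rfl fun i _ => ?_
    rw [mul_mul_mul_comm, ← C_mul, ← pow_add, map_C_mul]
    ring
  rw [hG, Matrix.det_mul, Matrix.det_mul, Matrix.det_transpose, hE, hF, prod_mul_distrib,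
    ← Fin.prod_univ_eq_prod_range (fun r => (e r).coeff r),
    ← Fin.prod_univ_eq_prod_range (fun r => (f r).coeff r)]
  ring

/-- If the first two rows of a matrix vanish to the right of the diagonal, its determinant splits
off the first two diagonal entries. -/
lemma det_succ_succ_of_rows_zero {N : ℕ} (A : ℕ → ℕ → K) (h0 : ∀ s, A 0 (s + 1) = 0)
    (h1 : ∀ s, A 1 (s + 2) = 0) :
    Matrix.det (Matrix.of fun r s : Fin (N + 2) => A r s) =
      A 0 0 * A 1 1 * Matrix.det (Matrix.of fun r s : Fin N => A (r + 2) (s + 2)) := by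
  rw [Matrix.det_succ_row_zero, Fin.sum_univ_succ, sum_eq_zero, add_zero, Matrix.det_succ_row_zero,
    Fin.sum_univ_succ, sum_eq_zero, add_zero]
  · simp [Matrix.submatrix, mul_assoc]
  · intro i _
    simp [h1]
  · intro i _
    simp [h0]

lemma det_mul_row_mul_column (x y : ℕ → K) (A : ℕ → ℕ → K) (N : ℕ) :
    Matrix.det (Matrix.of fun r s : Fin N => x r * y s * A r s) =
      (∏ r ∈ range N, x r * y r) * Matrix.det (Matrix.of fun r s : Fin N => A r s) := by
  have h1 := Matrix.det_mul_column (fun r : Fin N => x r)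
    (Matrix.of fun r s : Fin N => y s * A r s)
  have h2 := Matrix.det_mul_row (fun s : Fin N => y s) (Matrix.of fun r s : Fin N => A r s)
  simp only [Matrix.of_apply, ← mul_assoc] at h1 h2
  rw [h1, h2, Fin.prod_univ_eq_prod_range, Fin.prod_univ_eq_prod_range, prod_mul_distrib, mul_assoc]

/-! ### The Hankel determinant of `1 / (c; p)_⌈n/2⌉` -/

lemma qPoch_zero (x p : K) : qPoch x p 0 = 1 := by simp [qPoch]

lemma qPoch_succ (x p : K) (n : ℕ) : qPoch x p (n + 1) = qPoch x p n * (1 - x * p ^ n) :=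
  prod_range_succ _ _

lemma qPoch_add_two (x p : K) (n : ℕ) :
    qPoch x p (n + 2) = (1 - x) * (1 - x * p) * qPoch (x * p ^ 2) p n := by
  have h : ∏ i ∈ range n, (1 - x * p ^ (i + 1 + 1)) = ∏ i ∈ range n, (1 - x * p ^ 2 * p ^ i) :=
    prod_congr rfl fun i _ => by ring
  rw [qPoch, prod_range_succ', prod_range_succ', h, qPoch]
  ring

lemma qPoch_ne_zero {x p : K} (h : ∀ i : ℕ, 1 - x * p ^ i ≠ 0) (n : ℕ) : qPoch x p n ≠ 0 :=
  prod_ne_zero_iff.2 fun i _ => h i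

/-- The sequence `1 / (c; p)_⌈n/2⌉`. For `c = q`, `p = q ^ 2` these are the moments at `a = 0`. -/
def invPoch (c p : K) (n : ℕ) : K := 1 / qPoch c p ((n + 1) / 2)

/-- The polynomials whose pairing with the powers of `X` under the moments `1 / (c; p)_⌈n/2⌉`
clears the first two rows of the Hankel matrix and reproduces, up to row and column factors, the
Hankel matrix with `c` replaced by `c p ^ 2` in the rest. -/
noncomputable def elimPoly (c p : K) : ℕ → K[X]
  | 0 => 1
  | 1 => C (1 - c) * X - 1
  | s + 2 =>
    if Even s then
      C (1 - c * p ^ (s / 2 + 1)) * (X ^ (s + 2) - X ^ (s + 1)) +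
        C p * (C (1 - c * p ^ (s / 2)) * X ^ (s + 1) - X ^ s)
    else C (1 - c * p ^ (s / 2 + 1)) * X ^ (s + 2) - X ^ s

lemma natDegree_elimPoly_le (c p : K) (s : ℕ) : (elimPoly c p s).natDegree ≤ s := by
  match s with
  | 0 => simp [elimPoly]
  | 1 => rw [elimPoly]; compute_degree
  | s + 2 =>
    rw [elimPoly]
    split_ifs
    · compute_degree
    · compute_degree

lemma coeff_elimPoly_add_two (c p : K) (s : ℕ) :
    (elimPoly c p (s + 2)).coeff (s + 2) = 1 - c * p ^ (s / 2 + 1) := by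
  rw [elimPoly]
  split_ifs
  · simp [coeff_X_pow, coeff_sub, coeff_add, -map_sub, -map_mul]
  · simp [coeff_X_pow, coeff_sub, -map_sub, -map_mul]

/-- The factor `1 - p ^ ⌊r/2⌋` vanishes for `r = 0, 1`, so that the first two rows are cleared. -/
lemma momentFunctional_X_pow_mul_elimPoly {c p : K} (hc : ∀ i : ℕ, 1 - c * p ^ i ≠ 0) (r s : ℕ) :
    momentFunctional (invPoch c p) (X ^ r * elimPoly c p (s + 2)) =
      -(c * p ^ (s / 2 + 1) * (1 - p ^ (r / 2))) * invPoch c p (r + s + 2) := by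
  have hL (x : K) (g : K[X]) : momentFunctional (invPoch c p) (X ^ r * (C x * g)) =
      x * momentFunctional (invPoch c p) (X ^ r * g) := by
    rw [mul_left_comm, map_C_mul]
  have hX (n : ℕ) : momentFunctional (invPoch c p) (X ^ r * X ^ n) = invPoch c p (r + n) := by
    rw [← pow_add, momentFunctional_X_pow]
  obtain ⟨j, rfl | rfl⟩ := Nat.even_or_odd' r <;> obtain ⟨i, rfl | rfl⟩ := Nat.even_or_odd' s
  · rw [elimPoly, if_pos (by simp), mul_add, LinearMap.map_add]
    simp only [hL, mul_sub (X ^ _), LinearMap.map_sub, hX, invPoch]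
    rw [show (2 * j + (2 * i + 2) + 1) / 2 = j + i + 1 by omega,
      show (2 * j + (2 * i + 1) + 1) / 2 = j + i + 1 by omega,
      show (2 * j + 2 * i + 2 + 1) / 2 = j + i + 1 by omega,
      show (2 * j + 2 * i + 1) / 2 = j + i by omega, qPoch_succ,
      show 2 * i / 2 = i by omega, show 2 * j / 2 = j by omega]
    have h1 := qPoch_ne_zero hc (j + i)
    have h2 := hc (j + i)
    field_simp
    ring
  · rw [elimPoly, if_neg (by simp)]
    simp only [hL, mul_sub (X ^ _), LinearMap.map_sub, hX, invPoch]
    rw [show (2 * j + (2 * i + 1 + 2) + 1) / 2 = j + i + 1 + 1 by omega,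
      show (2 * j + (2 * i + 1) + 1) / 2 = j + i + 1 by omega,
      show (2 * j + (2 * i + 1) + 2 + 1) / 2 = j + i + 1 + 1 by omega, qPoch_succ _ _ (j + i + 1),
      show (2 * i + 1) / 2 = i by omega, show 2 * j / 2 = j by omega]
    have h1 := qPoch_ne_zero hc (j + i + 1)
    have h2 := hc (j + i + 1)
    field_simp
    ring
  · rw [elimPoly, if_pos (by simp), mul_add, LinearMap.map_add]
    simp only [hL, mul_sub (X ^ _), LinearMap.map_sub, hX, invPoch]
    rw [show (2 * j + 1 + (2 * i + 2) + 1) / 2 = j + i + 1 + 1 by omega,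
      show (2 * j + 1 + (2 * i + 1) + 1) / 2 = j + i + 1 by omega,
      show (2 * j + 1 + 2 * i + 2 + 1) / 2 = j + i + 1 + 1 by omega,
      show (2 * j + 1 + 2 * i + 1) / 2 = j + i + 1 by omega, qPoch_succ _ _ (j + i + 1),
      show 2 * i / 2 = i by omega, show (2 * j + 1) / 2 = j by omega]
    have h1 := qPoch_ne_zero hc (j + i + 1)
    have h2 := hc (j + i + 1)
    field_simp
    ring
  · rw [elimPoly, if_neg (by simp)]
    simp only [hL, mul_sub (X ^ _), LinearMap.map_sub, hX, invPoch]
    rw [show (2 * j + 1 + (2 * i + 1 + 2) + 1) / 2 = j + i + 1 + 1 by omega,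
      show (2 * j + 1 + (2 * i + 1) + 1) / 2 = j + i + 1 by omega,
      show (2 * j + 1 + (2 * i + 1) + 2 + 1) / 2 = j + i + 1 + 1 by omega,
      qPoch_succ _ _ (j + i + 1),
      show (2 * i + 1) / 2 = i by omega, show (2 * j + 1) / 2 = j by omega]
    have h1 := qPoch_ne_zero hc (j + i + 1)
    have h2 := hc (j + i + 1)
    field_simp
    ring

/-- The squared norms of the monic orthogonal polynomials for the moments `1 / (c; p)_⌈n/2⌉`,
through the recursion on the degree that replaces `c` by `c p ^ 2`. The factor of index `m + 2` is
the quotient of the factors of row and column `m` of the reduced matrix by the leading coefficient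
of `elimPoly c p (m + 2)`. -/
def invPochNorm (p : K) : ℕ → K → K
  | 0, _ => 1
  | 1, c => -c / (1 - c) ^ 2
  | m + 2, c =>
    -(c * p ^ (m / 2 + 1) * (1 - p ^ (m / 2 + 1))) /
      ((1 - c) * (1 - c * p) * (1 - c * p ^ (m / 2 + 1))) * invPochNorm p m (c * p ^ 2)

lemma one_sub_shift_ne_zero {c p : K} (hc : ∀ i : ℕ, 1 - c * p ^ i ≠ 0) (i : ℕ) :
    1 - c * p ^ 2 * p ^ i ≠ 0 := by
  rw [mul_assoc, ← pow_add]
  exact hc _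

/-- Clearing the first two rows by column operations leaves a matrix of the same shape with `c`
replaced by `c p ^ 2`, whence an induction in steps of two. -/
lemma det_invPoch (p : K) (N : ℕ) : ∀ c : K, (∀ i : ℕ, 1 - c * p ^ i ≠ 0) →
    Matrix.det (Matrix.of fun r s : Fin N => invPoch c p ((r : ℕ) + s)) =
      ∏ m ∈ range N, invPochNorm p m c := by
  induction N using Nat.twoStepInduction with
  | zero => intro c _; simp
  | one => intro c _; simp [invPoch, invPochNorm, qPoch]
  | more N ih _ =>
    intro c hc
    have hc0 : 1 - c ≠ 0 := by simpa using hc 0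
    have hc1 : 1 - c * p ≠ 0 := by simpa using hc 1
    have hgram := det_gram_eq (momentFunctional (invPoch c p)) (fun r => X ^ r) (elimPoly c p)
      (fun r => natDegree_X_pow_le r) (natDegree_elimPoly_le c p) (N + 2)
    simp only [momentFunctional_X_pow] at hgram
    rw [det_succ_succ_of_rows_zero
      (fun r s => momentFunctional (invPoch c p) (X ^ r * elimPoly c p s)), prod_range_succ',
      prod_range_succ'] at hgram
    · have h11 : momentFunctional (invPoch c p) (X ^ 1 * elimPoly c p 1) = -c / (1 - c) := by
        have : (X : K[X]) ^ 1 * elimPoly c p 1 = C (1 - c) * X ^ 2 - X ^ 1 := by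
          rw [elimPoly]; ring
        rw [this, LinearMap.map_sub, map_C_mul, momentFunctional_X_pow, momentFunctional_X_pow]
        simp only [invPoch, qPoch]
        simp
        field_simp
        ring
      have h00 : momentFunctional (invPoch c p) (X ^ 0 * elimPoly c p 0) = 1 := by
        rw [elimPoly, mul_one, momentFunctional_X_pow]
        simp [invPoch, qPoch]
      have hrest : Matrix.det (Matrix.of fun r s : Fin N =>
          momentFunctional (invPoch c p) (X ^ ((r : ℕ) + 2) * elimPoly c p (s + 2))) =
          (∏ m ∈ range N, -(c * p ^ (m / 2 + 1) * (1 - p ^ (m / 2 + 1))) /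
            ((1 - c) * (1 - c * p))) *
          ∏ m ∈ range N, invPochNorm p m (c * p ^ 2) := by
        rw [← ih _ (one_sub_shift_ne_zero hc)]
        have hd := det_mul_row_mul_column
          (fun r => -(1 - p ^ (r / 2 + 1)) / ((1 - c) * (1 - c * p)))
          (fun s => c * p ^ (s / 2 + 1)) (fun r s => invPoch (c * p ^ 2) p (r + s)) N
        convert hd using 2
        · congr 1
          ext r s
          rw [momentFunctional_X_pow_mul_elimPoly hc, invPoch, invPoch,
            show ((r : ℕ) + 2 + s + 2 + 1) / 2 = (r + s + 1) / 2 + 2 by omega, qPoch_add_two,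
            show ((r : ℕ) + 2) / 2 = r / 2 + 1 by omega]
          have h1 := qPoch_ne_zero (one_sub_shift_ne_zero hc) ((r + s + 1) / 2)
          field_simp
        · exact prod_congr rfl fun m _ => by ring
      have hprod : ∏ m ∈ range N, (1 - c * p ^ (m / 2 + 1)) ≠ 0 :=
        prod_ne_zero_iff.2 fun m _ => hc _
      have hX (m : ℕ) : (X ^ m : K[X]).coeff m = 1 := by simp
      simp only [hX, one_mul, coeff_elimPoly_add_two] at hgram
      rw [h11, h00, hrest] at hgram
      have e1 : (elimPoly c p (0 + 1)).coeff (0 + 1) = 1 - c := by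
        simp [elimPoly, -map_sub, coeff_one]
      have e0 : (elimPoly c p 0).coeff 0 = 1 := by simp [elimPoly]
      rw [e1, e0] at hgram
      rw [prod_range_succ', prod_range_succ']
      simp only [invPochNorm]
      rw [prod_mul_distrib]
      have hsplit : ∏ m ∈ range N, -(c * p ^ (m / 2 + 1) * (1 - p ^ (m / 2 + 1))) /
            ((1 - c) * (1 - c * p) * (1 - c * p ^ (m / 2 + 1))) =
          (∏ m ∈ range N, -(c * p ^ (m / 2 + 1) * (1 - p ^ (m / 2 + 1))) /
            ((1 - c) * (1 - c * p))) / ∏ m ∈ range N, (1 - c * p ^ (m / 2 + 1)) := by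
        rw [← prod_div_distrib]
        exact prod_congr rfl fun m _ => by rw [div_div]
      rw [hsplit]
      have hk : (∏ m ∈ range N, (1 - c * p ^ (m / 2 + 1))) * (1 - c) ≠ 0 := mul_ne_zero hprod hc0
      apply mul_left_cancel₀ hk
      rw [mul_one] at hgram
      rw [← hgram]
      field_simp
    · intro s
      match s with
      | 0 =>
        have : (X : K[X]) ^ 0 * elimPoly c p (0 + 1) = C (1 - c) * X ^ 1 - X ^ 0 := by
          simp only [elimPoly]; ring
        rw [this, LinearMap.map_sub, map_C_mul, momentFunctional_X_pow, momentFunctional_X_pow]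
        simp only [invPoch, qPoch]
        simp [hc0]
      | s + 1 =>
        rw [momentFunctional_X_pow_mul_elimPoly hc]
        simp
    · intro s
      rw [momentFunctional_X_pow_mul_elimPoly hc]
      simp

/-- The ratio of consecutive values of `invPochNorm`; for `c = q`, `p = q ^ 2` it is the
coefficient of the three-term recurrence at `a = 0`. -/
def invPochLambda (c p : K) (n : ℕ) : K :=
  if Even n then
    p ^ (n / 2) * (1 - c * p ^ (n / 2 - 1)) * (1 - p ^ (n / 2)) / (1 - c * p ^ (n - 1)) ^ 2
  else -(c * p ^ (n - 1)) / (1 - c * p ^ (n - 1)) ^ 2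

lemma invPochNorm_succ (p : K) (m : ℕ) :
    ∀ c : K, (∀ i : ℕ, 1 - c * p ^ i ≠ 0) →
      invPochNorm p (m + 1) c = invPochLambda c p (m + 1) * invPochNorm p m c := by
  induction m using Nat.twoStepInduction with
  | zero => intro c _; simp [invPochNorm, invPochLambda]
  | one =>
    intro c hc
    have hc0 : 1 - c ≠ 0 := by simpa using hc 0
    have hc1 : 1 - c * p ≠ 0 := by simpa using hc 1
    simp only [invPochNorm, invPochLambda]
    norm_num
    field_simp
  | more m ih _ =>
    intro c hc
    have hc0 : 1 - c ≠ 0 := by simpa using hc 0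
    have hc1 : 1 - c * p ≠ 0 := by simpa using hc 1
    rw [show m + 2 + 1 = m + 1 + 2 from rfl, invPochNorm, invPochNorm,
      ih _ (one_sub_shift_ne_zero hc)]
    obtain ⟨k, rfl | rfl⟩ := Nat.even_or_odd' m
    · rw [invPochLambda, invPochLambda, if_neg (by simp), if_neg (by simp [Nat.even_add_one]),
        show (2 * k + 1) / 2 = k by omega, show 2 * k / 2 = k by omega,
        show 2 * k + 1 - 1 = 2 * k by omega, show 2 * k + 1 + 2 - 1 = 2 * k + 2 by omega]
      have h1 := hc (k + 1)
      have h2 := hc (2 * k + 2)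
      rw [show c * p ^ 2 * p ^ (2 * k) = c * p ^ (2 * k + 2) by ring]
      field_simp
    · rw [invPochLambda, invPochLambda, if_pos (by simp [Nat.even_add_one]),
        if_pos (by simp [Nat.even_add_one]),
        show (2 * k + 1 + 1) / 2 = k + 1 by omega, show (2 * k + 1) / 2 = k by omega,
        show (2 * k + 1 + 1 + 2) / 2 = k + 2 by omega,
        show 2 * k + 1 + 1 - 1 = 2 * k + 1 by omega,
        show 2 * k + 1 + 1 + 2 - 1 = 2 * k + 3 by omega,
        show k + 1 - 1 = k by omega, show k + 2 - 1 = k + 1 by omega]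
      have h1 := hc (k + 1)
      have h2 := hc (2 * k + 3)
      have h3 := hc (k + 2)
      rw [show c * p ^ 2 * p ^ (2 * k + 1) = c * p ^ (2 * k + 3) by ring,
        show c * p ^ 2 * p ^ k = c * p ^ (k + 2) by ring, show k + 1 + 1 = k + 2 from rfl]
      field_simp

/-! ### The moments `P_n(a)` -/

lemma qBinom_zero_right {q : K} (hq : ∀ i : ℕ, 1 - q * q ^ i ≠ 0) (n : ℕ) : qBinom q n 0 = 1 := by
  simp [qBinom, qPoch_zero, qPoch_ne_zero hq]

lemma qBinom_self {q : K} (hq : ∀ i : ℕ, 1 - q * q ^ i ≠ 0) (n : ℕ) : qBinom q n n = 1 := by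
  simp [qBinom, qPoch_zero, qPoch_ne_zero hq]

lemma qBinom_add_two {q : K} (hq : ∀ i : ℕ, 1 - q * q ^ i ≠ 0) {n j : ℕ} (hj : j ≤ n) :
    qBinom q (n + 2) (j + 1) =
      qBinom q (n + 1) (j + 1) + qBinom q (n + 1) j - (1 - q ^ (n + 1)) * qBinom q n j := by
  obtain ⟨l, rfl⟩ := Nat.exists_eq_add_of_le hj
  simp only [qBinom]
  rw [show j + l + 2 - (j + 1) = l + 1 by omega, show j + l + 1 - (j + 1) = l by omega,
    show j + l + 1 - j = l + 1 by omega, show j + l - j = l by omega, qPoch_succ _ _ (j + l + 1),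
    qPoch_succ _ _ (j + l), qPoch_succ _ _ j, qPoch_succ _ _ l]
  have h1 := qPoch_ne_zero hq j
  have h2 := qPoch_ne_zero hq l
  have h3 := hq j
  have h4 := hq l
  field_simp
  ring

/-- The Rogers–Szegő polynomial `∑_k [n choose k]_q a^k`. -/
def rogersSzego (q a : K) (n : ℕ) : K := ∑ k ∈ range (n + 1), qBinom q n k * a ^ k

/-- The three-term recurrence of the Rogers–Szegő polynomials. -/
lemma rogersSzego_add_two {q : K} (hq : ∀ i : ℕ, 1 - q * q ^ i ≠ 0) (a : K) (n : ℕ) :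
    rogersSzego q a (n + 2) =
      (1 + a) * rogersSzego q a (n + 1) - (1 - q ^ (n + 1)) * a * rogersSzego q a n := by
  have h2 : rogersSzego q a (n + 2) =
      ∑ j ∈ range (n + 1), qBinom q (n + 2) (j + 1) * a ^ (j + 1) + 1 + a ^ (n + 2) := by
    rw [rogersSzego, sum_range_succ, sum_range_succ', qBinom_self hq, qBinom_zero_right hq]
    ring
  have h1 : rogersSzego q a (n + 1) =
      ∑ j ∈ range (n + 1), qBinom q (n + 1) (j + 1) * a ^ (j + 1) + 1 := by
    rw [rogersSzego, sum_range_succ', qBinom_zero_right hq]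
    ring
  have h1' : a * rogersSzego q a (n + 1) =
      ∑ j ∈ range (n + 1), qBinom q (n + 1) j * a ^ (j + 1) + a ^ (n + 2) := by
    rw [rogersSzego, sum_range_succ, qBinom_self hq, mul_add, mul_sum]
    congr 1
    · exact sum_congr rfl fun _ _ => by ring
    · ring
  have h0 : (1 - q ^ (n + 1)) * a * rogersSzego q a n =
      ∑ j ∈ range (n + 1), (1 - q ^ (n + 1)) * qBinom q n j * a ^ (j + 1) := by
    rw [rogersSzego, mul_sum]
    exact sum_congr rfl fun _ _ => by ring
  rw [one_add_mul, h1', h0, h1, h2,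
    sum_congr rfl fun j hj => by rw [qBinom_add_two hq (Nat.lt_succ_iff.1 (mem_range.1 hj))]]
  simp only [sub_mul, add_mul, sum_sub_distrib, sum_add_distrib]
  ring

lemma P_eq (q a : K) (n : ℕ) : P q a n = invPoch q (q ^ 2) n * rogersSzego q a n := rfl

lemma one_sub_mul_sq_pow_ne_zero {q : K} (hq : ∀ i : ℕ, 1 - q * q ^ i ≠ 0) (i : ℕ) :
    1 - q * (q ^ 2) ^ i ≠ 0 := by
  rw [← pow_mul]
  exact hq _

lemma P_zero (q a : K) : P q a 0 = 1 := by
  simp [P, qBinom, qPoch]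

lemma P_even_add_two {q : K} (hq : ∀ i : ℕ, 1 - q * q ^ i ≠ 0) (a : K) (m : ℕ) :
    P q a (2 * m + 2) = (1 + a) * P q a (2 * m + 1) - a * P q a (2 * m) := by
  have h1 := one_sub_mul_sq_pow_ne_zero hq m
  have h2 := qPoch_ne_zero (one_sub_mul_sq_pow_ne_zero hq) m
  rw [P_eq, P_eq, P_eq, rogersSzego_add_two hq, invPoch, invPoch, invPoch,
    show (2 * m + 2 + 1) / 2 = m + 1 by omega, show (2 * m + 1 + 1) / 2 = m + 1 by omega,
    show (2 * m + 1) / 2 = m by omega, qPoch_succ]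
  field_simp
  ring

lemma P_odd_add_two {q : K} (hq : ∀ i : ℕ, 1 - q * q ^ i ≠ 0) (a : K) (m : ℕ) :
    (1 - q ^ (2 * m + 3)) * P q a (2 * m + 3) =
      (1 + a) * P q a (2 * m + 2) - (1 - q ^ (2 * m + 2)) * a * P q a (2 * m + 1) := by
  have h1 := one_sub_mul_sq_pow_ne_zero hq (m + 1)
  have h2 := qPoch_ne_zero (one_sub_mul_sq_pow_ne_zero hq) (m + 1)
  rw [P_eq, P_eq, P_eq, rogersSzego_add_two hq, invPoch, invPoch, invPoch,
    show (2 * m + 1 + 2 + 1) / 2 = m + 1 + 1 by omega,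
    show (2 * m + 2 + 1) / 2 = m + 1 by omega,
    show (2 * m + 1 + 1) / 2 = m + 1 by omega, qPoch_succ _ _ (m + 1)]
  field_simp
  ring

/-! ### The functional with moments `P_n(a)` and its even part -/

/-- The functional on `K[X]` with moments `P_n(a)`. -/
noncomputable def momentP (q a : K) : K[X] →ₗ[K] K := momentFunctional (P q a)

/-- The even part `f ↦ momentP (f(X ^ 2))` of `momentP`, whose moments are the `P_{2n}(a)`. -/
noncomputable def momentPEven (q a : K) : K[X] →ₗ[K] K :=
  momentP q a ∘ₗ (expand K 2).toLinearMap

lemma momentPEven_apply (q a : K) (f : K[X]) : momentPEven q a f = momentP q a (expand K 2 f) := rfl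

lemma momentPEven_X_pow (q a : K) (n : ℕ) : momentPEven q a (X ^ n) = P q a (2 * n) := by
  rw [momentPEven_apply, map_pow, expand_X, ← pow_mul, momentP, momentFunctional_X_pow]

/-- The functional `momentP` vanishes on `(X - 1) (X - a) f(X ^ 2)`. -/
lemma momentP_mul_expand {q : K} (hq : ∀ i : ℕ, 1 - q * q ^ i ≠ 0) (a : K) (f : K[X]) :
    momentP q a ((X - 1) * (X - C a) * expand K 2 f) = 0 := by
  induction f using Polynomial.induction_on' with
  | add f g hf hg => rw [map_add, mul_add, LinearMap.map_add, hf, hg, add_zero]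
  | monomial n c =>
    have : (X - 1) * (X - C a) * expand K 2 (monomial n c) =
        C c * (X ^ (2 * n + 2) - C (1 + a) * X ^ (2 * n + 1) + C a * X ^ (2 * n)) := by
      rw [← C_mul_X_pow_eq_monomial, map_mul, map_pow, expand_C, expand_X, ← pow_mul, C_add, C_1]
      ring
    rw [this, map_C_mul, LinearMap.map_add, LinearMap.map_sub, map_C_mul, map_C_mul]
    simp only [momentP, momentFunctional_X_pow]
    rw [P_even_add_two hq]
    ring

/-- The odd part of `momentP` is determined by its even part. -/
lemma momentP_X_mul_expand {q : K} (hq : ∀ i : ℕ, 1 - q * q ^ i ≠ 0) (a : K) (f : K[X]) :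
    (1 + a) * momentP q a (X * expand K 2 f) = momentPEven q a ((X + C a) * f) := by
  have h := momentP_mul_expand hq a f
  have e : (X - 1) * (X - C a) * expand K 2 f =
      expand K 2 ((X + C a) * f) - C (1 + a) * (X * expand K 2 f) := by
    rw [map_mul, map_add, expand_C, expand_X, C_add, C_1]
    ring
  rw [e, LinearMap.map_sub, map_C_mul, ← momentPEven_apply] at h
  linear_combination -h

/-- The square of `(X - 1) (X - a)` turns the even part of `momentP` into the left side of
`momentPEven_pearson`. -/
lemma momentP_sq_mul_expand {q : K} (hq : ∀ i : ℕ, 1 - q * q ^ i ≠ 0) (a : K) (f : K[X]) :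
    momentP q a (((X - 1) * (X - C a)) ^ 2 * expand K 2 f) =
      -momentPEven q a ((X - 1) * (X - C (a ^ 2)) * f) := by
  have h := momentP_mul_expand hq a ((X + C a) * f)
  have hX := momentP_X_mul_expand hq a ((X + C a) * f)
  have e : ((X - 1) * (X - C a)) ^ 2 * expand K 2 f =
      (X - 1) * (X - C a) * expand K 2 ((X + C a) * f) -
        C (1 + a) * (X * expand K 2 ((X + C a) * f)) +
        C ((1 + a) ^ 2) * expand K 2 (X * f) := by
    simp only [map_mul, map_add, expand_C, expand_X, map_pow, C_1]
    ring
  have e2 : (X - 1) * (X - C (a ^ 2)) * f =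
      (X + C a) * ((X + C a) * f) - C ((1 + a) ^ 2) * (X * f) := by
    simp only [map_add, map_pow, C_1]
    ring
  rw [e, LinearMap.map_add, LinearMap.map_sub, h, map_C_mul, map_C_mul, hX, ← momentPEven_apply,
    e2, LinearMap.map_sub, map_C_mul]
  ring

/-- The `q`-difference equation satisfied by the even part of the moment functional. -/
lemma momentPEven_pearson {q : K} (hq : ∀ i : ℕ, 1 - q * q ^ i ≠ 0) (a : K) (f : K[X]) :
    momentPEven q a ((X - 1) * (X - C (a ^ 2)) * f) =
      q ^ 2 * momentPEven q a ((C a + X) * (C a + C q * X) * f.comp (C (q ^ 2) * X)) := by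
  induction f using Polynomial.induction_on' with
  | add f g hf hg => rw [add_comp, mul_add ((X - 1) * _), mul_add (_ * _) (f.comp _),
      LinearMap.map_add, LinearMap.map_add, hf, hg, mul_add (q ^ 2)]
  | monomial n c =>
    have e1 : (X - 1) * (X - C (a ^ 2)) * monomial n c =
        C c * (X ^ (n + 2) - C (1 + a ^ 2) * X ^ (n + 1) + C (a ^ 2) * X ^ n) := by
      rw [← C_mul_X_pow_eq_monomial, C_add, C_1]
      ring
    have e2 : (C a + X) * (C a + C q * X) * (monomial n c).comp (C (q ^ 2) * X) =
        C (c * q ^ (2 * n)) *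
          (C q * X ^ (n + 2) + C ((q + 1) * a) * X ^ (n + 1) + C (a ^ 2) * X ^ n) := by
      rw [monomial_comp]
      simp only [map_mul, map_add, map_pow, C_1, mul_pow, ← pow_mul]
      ring
    rw [e1, e2, map_C_mul, map_C_mul]
    simp only [LinearMap.map_add, LinearMap.map_sub, map_C_mul, momentPEven_X_pow]
    have h0 := P_even_add_two hq a n
    have h1 := P_even_add_two hq a (n + 1)
    have h2 := P_odd_add_two hq a n
    rw [show 2 * (n + 1) + 2 = 2 * (n + 2) by ring, show 2 * (n + 1) + 1 = 2 * n + 3 by ring] at h1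
    rw [show 2 * n + 2 = 2 * (n + 1) by ring] at h0 h2
    have e3 : q ^ (2 * n + 3) = q ^ (2 * n) * q ^ 3 := by ring
    have e4 : q ^ (2 * (n + 1)) = q ^ (2 * n) * q ^ 2 := by ring
    rw [e3, e4] at h2
    linear_combination c * (1 + a) * h2 + c * (1 - q ^ (2 * n) * q ^ 3) * h1 +
      c * (1 - q ^ (2 * n) * q ^ 2) * a * h0

/-! ### Two product bases and their pairing -/

/-- The product `∏_{i<j} (a + b p^i X)`. -/
noncomputable def linProd (a b p : K) (j : ℕ) : K[X] := ∏ i ∈ range j, (C a + C (b * p ^ i) * X)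

lemma linProd_succ (a b p : K) (j : ℕ) :
    linProd a b p (j + 1) = linProd a b p j * (C a + C (b * p ^ j) * X) := prod_range_succ _ _

lemma linProd_succ_eq_comp (a b p : K) (j : ℕ) :
    linProd a b p (j + 1) = (C a + C b * X) * (linProd a b p j).comp (C p * X) := by
  rw [linProd, prod_range_succ', mul_comm, linProd, Polynomial.prod_comp]
  congr 1
  · simp
  · refine prod_congr rfl fun i _ => ?_
    simp [pow_succ]
    ring

lemma natDegree_linProd_le (a b p : K) (j : ℕ) : (linProd a b p j).natDegree ≤ j := by
  induction j with
  | zero => simp [linProd]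
  | succ j ih =>
    rw [linProd_succ]
    refine natDegree_mul_le_of_le ih ?_
    compute_degree

lemma coeff_linProd (a b p : K) (j : ℕ) : (linProd a b p j).coeff j = ∏ i ∈ range j, b * p ^ i := by
  induction j with
  | zero => simp [linProd]
  | succ j ih =>
    rw [linProd_succ, coeff_mul_add_eq_of_natDegree_le (natDegree_linProd_le a b p j)
      (by compute_degree), ih, prod_range_succ]
    simp [coeff_C, -map_mul]

/-- The product `∏_{i<j} (1 + a b p^i) (a + b p^i)`. -/
def symProd (a b p : K) (j : ℕ) : K := ∏ i ∈ range j, (1 + a * (b * p ^ i)) * (a + b * p ^ i)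

lemma symProd_succ (a b p : K) (j : ℕ) :
    symProd a b p (j + 1) = symProd a b p j * ((1 + a * (b * p ^ j)) * (a + b * p ^ j)) :=
  prod_range_succ _ _

/-- Written in terms of the products `linProd`, the difference equation `momentPEven_pearson` is a
three-term recurrence for their values, which determines them from the first two. -/
lemma momentPEven_linProd {q : K} (hq : ∀ i : ℕ, 1 - q * q ^ i ≠ 0) (a : K) (j : ℕ) :
    momentPEven q a (linProd a 1 (q ^ 2) j) = symProd a 1 (q ^ 2) j / qPoch q (q ^ 2) j := by
  have hqp := one_sub_mul_sq_pow_ne_zero hq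
  have hq0 : 1 - q ≠ 0 := by simpa using hq 0
  induction j using Nat.twoStepInduction with
  | zero =>
    have := momentPEven_X_pow q a 0
    rw [pow_zero, mul_zero, P_zero] at this
    simp [linProd, symProd, qPoch, this]
  | one =>
    have h0 := momentPEven_X_pow q a 0
    have h1 := momentPEven_X_pow q a 1
    rw [pow_zero, mul_zero, P_zero] at h0
    have e : linProd a 1 (q ^ 2) 1 = X ^ 1 + C a * 1 := by
      simp [linProd]; ring
    rw [e, LinearMap.map_add, map_C_mul, h0, h1]
    have h2 := P_even_add_two hq a 0
    rw [P_zero] at h2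
    have h3 : P q a (2 * 0 + 1) = (1 + a) / (1 - q) := by
      rw [P, sum_range_succ, sum_range_one, qBinom_self hq, qBinom_zero_right hq]
      simp [qPoch]
      ring
    rw [show 2 * 1 = 2 * 0 + 2 from rfl, h2, h3]
    simp [symProd, qPoch]
    ring
  | more j ih0 ih1 =>
    have hpear := momentPEven_pearson hq a (linProd a 1 (q ^ 2) j)
    generalize hp : q ^ 2 = p at *
    have e1 : C (p ^ (2 * j + 1)) * ((X - 1) * (X - C (a ^ 2)) * linProd a 1 p j) =
        linProd a 1 p (j + 2) +
          C (-p ^ (j + 1) * (1 + a ^ 2) - a * (1 + p)) * linProd a 1 p (j + 1) +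
          C (p ^ (2 * j + 1) * a ^ 2 - a ^ 2 + a * (p ^ (j + 1) * (1 + a ^ 2) + a * (1 + p))) *
            linProd a 1 p j := by
      rw [linProd_succ, linProd_succ]
      simp only [map_mul, map_add, map_pow, map_sub, map_neg, C_1]
      ring
    have e2 : C (p ^ (2 * j + 1) * p) * ((C a + X) * (C a + C q * X) *
          (linProd a 1 p j).comp (C p * X)) =
        C (p ^ (j + 1)) * (C q * linProd a 1 p (j + 2) +
          C (a * (p ^ (j + 1) - q)) * linProd a 1 p (j + 1)) := by
      have := linProd_succ_eq_comp a 1 p j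
      rw [C_1, one_mul] at this
      rw [mul_right_comm, ← this, linProd_succ _ _ _ (j + 1)]
      simp only [map_mul, map_pow, map_sub, C_1]
      ring
    have e1' := congrArg (momentPEven q a) e1
    have e2' := congrArg (momentPEven q a) e2
    simp only [LinearMap.map_add, map_C_mul] at e1' e2'
    have h1 := hqp j
    have h2 := hqp (j + 1)
    have h3 := qPoch_ne_zero hqp j
    have key : (1 - q * p ^ (j + 1)) * momentPEven q a (linProd a 1 p (j + 2)) =
        (p ^ (j + 1) * (1 + a ^ 2) + a * (1 + p) + p ^ (j + 1) * (a * (p ^ (j + 1) - q))) *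
            momentPEven q a (linProd a 1 p (j + 1)) -
          (p ^ (2 * j + 1) * a ^ 2 - a ^ 2 + a * (p ^ (j + 1) * (1 + a ^ 2) + a * (1 + p))) *
            momentPEven q a (linProd a 1 p j) := by
      linear_combination e2' - e1' + p ^ (2 * j + 1) * hpear
    apply mul_left_cancel₀ h2
    rw [key, ih0, ih1, qPoch_succ _ _ (j + 1), qPoch_succ, symProd_succ _ _ _ (j + 1),
      symProd_succ]
    rw [show p ^ (2 * j + 1) = (p ^ j) ^ 2 * p by ring, pow_succ p j]
    rw [pow_succ p j] at h2
    generalize p ^ j = y at h1 h2 ⊢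
    -- The denominators in the order of factors to which `field_simp` normalizes them.
    have h1' : 1 - y * q ≠ 0 := by rwa [mul_comm]
    have h2' : 1 - y * p * q ≠ 0 := by rwa [mul_comm]
    field_simp
    ring

/-- The factors `a + p^j X`, `a + q p^k X` and `1` are linearly dependent, which moves factors from
the first product to the second and reduces the pairing to `momentPEven_linProd`. -/
lemma momentPEven_linProd_mul_linProd {q : K} (hq : ∀ i : ℕ, 1 - q * q ^ i ≠ 0) (hq0 : q ≠ 0)
    (a : K) (k : ℕ) : ∀ j : ℕ,
    momentPEven q a (linProd a 1 (q ^ 2) j * linProd a q (q ^ 2) k) =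
      symProd a 1 (q ^ 2) j * symProd a q (q ^ 2) k / qPoch q (q ^ 2) (j + k) := by
  have hqp := one_sub_mul_sq_pow_ne_zero hq
  have hp0 : q ^ 2 ≠ 0 := pow_ne_zero 2 hq0
  generalize hp : q ^ 2 = p at *
  induction k with
  | zero =>
    intro j
    have := momentPEven_linProd hq a j
    rw [hp] at this
    simpa [linProd, symProd] using this
  | succ k ih =>
    intro j
    have e : C (p ^ j) * (linProd a 1 p j * linProd a q p (k + 1)) =
        C (q * p ^ k) * (linProd a 1 p (j + 1) * linProd a q p k) -
          C (a * (q * p ^ k - p ^ j)) * (linProd a 1 p j * linProd a q p k) := by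
      rw [linProd_succ, linProd_succ]
      simp only [map_mul, map_pow, map_sub, C_1]
      ring
    have e' := congrArg (momentPEven q a) e
    rw [LinearMap.map_sub, map_C_mul, map_C_mul, map_C_mul, ih, ih] at e'
    apply mul_left_cancel₀ (pow_ne_zero j hp0)
    have h1 := hqp (j + k)
    have h2 := qPoch_ne_zero hqp (j + k)
    rw [e', show j + 1 + k = j + k + 1 by ring, show j + (k + 1) = j + k + 1 by ring, qPoch_succ,
      symProd_succ, symProd_succ]
    field_simp
    ring

/-! ### Bases adapted to the moment functional -/

/-- For `b = 1` or `b = q` and `p = q ^ 2`, the basis `∏_{i<j} (a + b p^i X²)` of the even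
polynomials, completed in degree `2j + 1` by the difference of its `(j + 1)`-st member and
`b p^j (X - 1) (X - a)` times its `j`-th member, in which the terms of degree `2j + 2` cancel. -/
noncomputable def gramBasis (a b p : K) (r : ℕ) : K[X] :=
  expand K 2 (linProd a b p (r / 2)) *
    if Even r then 1 else C (a * (1 - b * p ^ (r / 2))) + C (b * p ^ (r / 2) * (1 + a)) * X

lemma gramBasis_even (a b p : K) (j : ℕ) :
    gramBasis a b p (2 * j) = expand K 2 (linProd a b p j) := by
  simp [gramBasis]

lemma gramBasis_odd (a b p : K) (j : ℕ) :
    gramBasis a b p (2 * j + 1) = expand K 2 (linProd a b p (j + 1)) -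
      C (b * p ^ j) * ((X - 1) * (X - C a) * expand K 2 (linProd a b p j)) := by
  rw [gramBasis, if_neg (by simp), show (2 * j + 1) / 2 = j by omega, linProd_succ]
  simp only [map_mul, map_add, map_pow, map_sub, expand_C, expand_X, C_1]
  ring

lemma natDegree_expand_linProd_le (a b p : K) (j : ℕ) :
    (expand K 2 (linProd a b p j)).natDegree ≤ 2 * j := by
  have := natDegree_linProd_le a b p j
  rw [natDegree_expand]
  omega

lemma natDegree_gramBasis_le (a b p : K) (r : ℕ) : (gramBasis a b p r).natDegree ≤ r := by
  obtain ⟨j, rfl | rfl⟩ := Nat.even_or_odd' r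
  · rw [gramBasis_even]
    exact natDegree_expand_linProd_le a b p j
  · rw [gramBasis, if_neg (by simp), show (2 * j + 1) / 2 = j by omega]
    refine natDegree_mul_le_of_le (natDegree_expand_linProd_le a b p j) ?_
    compute_degree

lemma coeff_expand_linProd (a b p : K) (j : ℕ) :
    (expand K 2 (linProd a b p j)).coeff (2 * j) = ∏ i ∈ range j, b * p ^ i := by
  rw [mul_comm 2 j, coeff_expand_mul two_pos, coeff_linProd]

lemma coeff_gramBasis_even (a b p : K) (j : ℕ) :
    (gramBasis a b p (2 * j)).coeff (2 * j) = ∏ i ∈ range j, b * p ^ i := by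
  rw [gramBasis_even, coeff_expand_linProd]

lemma coeff_gramBasis_odd (a b p : K) (j : ℕ) :
    (gramBasis a b p (2 * j + 1)).coeff (2 * j + 1) =
      (1 + a) * ∏ i ∈ range (j + 1), b * p ^ i := by
  rw [gramBasis, if_neg (by simp), show (2 * j + 1) / 2 = j by omega,
    coeff_mul_add_eq_of_natDegree_le (natDegree_expand_linProd_le a b p j) (by compute_degree),
    coeff_expand_linProd, prod_range_succ, coeff_add, coeff_C_mul, coeff_X_one, coeff_C_succ]
  ring

/-- In the adapted bases the Gram matrix is, up to row and column factors, the Hankel matrix of the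
moments at `a = 0`. -/
lemma momentP_gramBasis_mul_gramBasis {q : K} (hq : ∀ i : ℕ, 1 - q * q ^ i ≠ 0) (hq0 : q ≠ 0)
    (a : K) (r s : ℕ) :
    momentP q a (gramBasis a 1 (q ^ 2) r * gramBasis a q (q ^ 2) s) =
      symProd a 1 (q ^ 2) ((r + 1) / 2) * symProd a q (q ^ 2) ((s + 1) / 2) *
        invPoch q (q ^ 2) (r + s) := by
  have hF (j k : ℕ) : momentP q a
      (expand K 2 (linProd a 1 (q ^ 2) j) * expand K 2 (linProd a q (q ^ 2) k)) =
      symProd a 1 (q ^ 2) j * symProd a q (q ^ 2) k / qPoch q (q ^ 2) (j + k) := by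
    rw [← map_mul, ← momentPEven_apply, momentPEven_linProd_mul_linProd hq hq0]
  have hW (j k : ℕ) : momentP q a ((X - 1) * (X - C a) *
      (expand K 2 (linProd a 1 (q ^ 2) j) * expand K 2 (linProd a q (q ^ 2) k))) = 0 := by
    rw [← map_mul, momentP_mul_expand hq]
  have hWW (j k : ℕ) : momentP q a (((X - 1) * (X - C a)) ^ 2 *
      (expand K 2 (linProd a 1 (q ^ 2) j) * expand K 2 (linProd a q (q ^ 2) k))) =
      -(q ^ 2 * (symProd a 1 (q ^ 2) (j + 1) * symProd a q (q ^ 2) (k + 1) /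
        qPoch q (q ^ 2) (j + 1 + (k + 1)))) := by
    rw [← map_mul, momentP_sq_mul_expand hq, momentPEven_pearson hq,
      ← momentPEven_linProd_mul_linProd hq hq0, linProd_succ_eq_comp, linProd_succ_eq_comp,
      mul_comp, C_1, one_mul]
    congr 3
    ring
  have hqp := one_sub_mul_sq_pow_ne_zero hq
  obtain ⟨j, rfl | rfl⟩ := Nat.even_or_odd' r <;> obtain ⟨k, rfl | rfl⟩ := Nat.even_or_odd' s
  · rw [gramBasis_even, gramBasis_even, hF, invPoch, show (2 * j + 1) / 2 = j by omega,
      show (2 * k + 1) / 2 = k by omega, show (2 * j + 2 * k + 1) / 2 = j + k by omega]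
    ring
  · rw [gramBasis_even, gramBasis_odd, mul_sub, mul_left_comm _ (C _), mul_left_comm _ (_ * _),
      LinearMap.map_sub, map_C_mul, hF, hW, invPoch, show (2 * j + 1) / 2 = j by omega,
      show (2 * k + 1 + 1) / 2 = k + 1 by omega,
      show (2 * j + (2 * k + 1) + 1) / 2 = j + (k + 1) by omega]
    ring
  · rw [gramBasis_even, gramBasis_odd, sub_mul, mul_assoc (C _), mul_assoc (_ * _),
      LinearMap.map_sub, map_C_mul, hF, hW, invPoch, show (2 * j + 1 + 1) / 2 = j + 1 by omega,
      show (2 * k + 1) / 2 = k by omega,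
      show (2 * j + 1 + 2 * k + 1) / 2 = j + 1 + k by omega]
    ring
  · rw [gramBasis_odd, gramBasis_odd]
    generalize hp : q ^ 2 = p at *
    have e : ∀ c d : K, ∀ w u u' v v' : K[X],
        (u' - C c * (w * u)) * (v' - C d * (w * v)) =
          u' * v' - C d * (w * (u' * v)) - C c * (w * (u * v')) +
            C (c * d) * (w ^ 2 * (u * v)) := by
      intros
      rw [C_mul]
      ring
    rw [e, LinearMap.map_add, LinearMap.map_sub, LinearMap.map_sub, map_C_mul, map_C_mul,
      map_C_mul, hF, hW, hW, hWW, invPoch, show (2 * j + 1 + 1) / 2 = j + 1 by omega,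
      show (2 * k + 1 + 1) / 2 = k + 1 by omega,
      show (2 * j + 1 + (2 * k + 1) + 1) / 2 = j + k + 1 by omega,
      show j + 1 + (k + 1) = j + k + 1 + 1 by ring, qPoch_succ _ _ (j + k + 1)]
    have h1 := hqp (j + k + 1)
    have h2 := qPoch_ne_zero hqp (j + k + 1)
    field_simp
    ring

/-! ### Evaluation of the determinant -/

/-- The quotient of the row and column factors of index `r` of the Gram matrix by the product of the
leading coefficients of the two adapted basis elements of degree `r`. -/
noncomputable def normRatio (q a : K) (r : ℕ) : K :=
  symProd a 1 (q ^ 2) ((r + 1) / 2) * symProd a q (q ^ 2) ((r + 1) / 2) /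
    ((gramBasis a 1 (q ^ 2) r).coeff r * (gramBasis a q (q ^ 2) r).coeff r)

lemma coeff_gramBasis_ne_zero {a b p : K} (ha : 1 + a ≠ 0) (hb : b ≠ 0) (hp : p ≠ 0) (r : ℕ) :
    (gramBasis a b p r).coeff r ≠ 0 := by
  have h (j : ℕ) : ∏ i ∈ range j, b * p ^ i ≠ 0 :=
    prod_ne_zero_iff.2 fun i _ => mul_ne_zero hb (pow_ne_zero i hp)
  obtain ⟨j, rfl | rfl⟩ := Nat.even_or_odd' r
  · rw [coeff_gramBasis_even]
    exact h j
  · rw [coeff_gramBasis_odd]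
    exact mul_ne_zero ha (h _)

lemma det_P_eq_prod {q a : K} (hq : ∀ i : ℕ, 1 - q * q ^ i ≠ 0) (hq0 : q ≠ 0) (ha : 1 + a ≠ 0)
    (N : ℕ) :
    Matrix.det (Matrix.of fun r s : Fin N => P q a ((r : ℕ) + s)) =
      ∏ m ∈ range N, normRatio q a m * invPochNorm (q ^ 2) m q := by
  have hp0 : q ^ 2 ≠ 0 := pow_ne_zero 2 hq0
  have h := det_gram_eq (momentP q a) (gramBasis a 1 (q ^ 2)) (gramBasis a q (q ^ 2))
    (natDegree_gramBasis_le a 1 (q ^ 2)) (natDegree_gramBasis_le a q (q ^ 2)) N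
  simp only [momentP_gramBasis_mul_gramBasis hq hq0] at h
  have hM := det_mul_row_mul_column (fun r => symProd a 1 (q ^ 2) ((r + 1) / 2))
    (fun s => symProd a q (q ^ 2) ((s + 1) / 2)) (fun r s => invPoch q (q ^ 2) (r + s)) N
  rw [hM, det_invPoch _ _ _ (one_sub_mul_sq_pow_ne_zero hq)] at h
  simp only [momentP, momentFunctional_X_pow] at h
  have hne : ∏ r ∈ range N,
      ((gramBasis a 1 (q ^ 2) r).coeff r * (gramBasis a q (q ^ 2) r).coeff r) ≠ 0 :=
    prod_ne_zero_iff.2 fun r _ => mul_ne_zero (coeff_gramBasis_ne_zero ha one_ne_zero hp0 r)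
      (coeff_gramBasis_ne_zero ha hq0 hp0 r)
  apply mul_left_cancel₀ hne
  rw [← h, ← prod_mul_distrib, ← prod_mul_distrib]
  refine prod_congr rfl fun r _ => ?_
  have h1 := coeff_gramBasis_ne_zero ha one_ne_zero hp0 r
  have h2 := coeff_gramBasis_ne_zero ha hq0 hp0 r
  rw [normRatio]
  field_simp

/-- Passing from `a = 0` to general `a` multiplies the recurrence coefficient of index `m + 1` by
`normRatio q a (m + 1) / normRatio q a m`. -/
lemma normRatio_succ_mul_invPochLambda {q a : K} (hq : ∀ i : ℕ, 1 - q * q ^ i ≠ 0) (hq0 : q ≠ 0)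
    (ha : 1 + a ≠ 0) (m : ℕ) :
    normRatio q a (m + 1) * invPochLambda q (q ^ 2) (m + 1) =
      recLambda q a (m + 1) * normRatio q a m := by
  have hp0 : q ^ 2 ≠ 0 := pow_ne_zero 2 hq0
  have hne (b : K) (hb : b ≠ 0) (j : ℕ) : ∏ i ∈ range j, b * (q ^ 2) ^ i ≠ 0 :=
    prod_ne_zero_iff.2 fun i _ => mul_ne_zero hb (pow_ne_zero i hp0)
  obtain ⟨j, rfl | rfl⟩ := Nat.even_or_odd' m
  · rw [normRatio, normRatio, coeff_gramBasis_odd, coeff_gramBasis_odd, coeff_gramBasis_even,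
      coeff_gramBasis_even, invPochLambda, recLambda, if_neg (by simp), if_neg (by simp),
      show (2 * j + 1 + 1) / 2 = j + 1 by omega, show (2 * j + 1) / 2 = j by omega,
      symProd_succ, symProd_succ, prod_range_succ, prod_range_succ,
      show 2 * j + 1 - 1 = 2 * j by omega, show 2 * (2 * j + 1) - 1 = 4 * j + 1 by omega]
    have h1 := hne 1 one_ne_zero j
    have h2 := hne q hq0 j
    have h3 := hq (4 * j)
    rw [show q * (q ^ 2) ^ (2 * j) = q * q ^ (4 * j) by ring,
      show q ^ (4 * j + 1) = q * q ^ (4 * j) by ring]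
    field_simp
    ring
  · rw [show 2 * j + 1 + 1 = 2 * (j + 1) by ring, normRatio, normRatio, coeff_gramBasis_odd,
      coeff_gramBasis_odd, coeff_gramBasis_even,
      coeff_gramBasis_even, invPochLambda, recLambda, if_pos (by simp), if_pos (by simp),
      show (2 * (j + 1) + 1) / 2 = j + 1 by omega, show (2 * j + 1 + 1) / 2 = j + 1 by omega,
      show (2 * (j + 1)) / 2 = j + 1 by omega, show j + 1 - 1 = j by omega,
      show 2 * (j + 1) - 1 = 2 * j + 1 by omega, show 2 * (2 * (j + 1)) - 1 = 4 * j + 3 by omega]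
    have h1 := hne 1 one_ne_zero (j + 1)
    have h2 := hne q hq0 (j + 1)
    have h3 := hq (4 * j + 2)
    rw [show q * (q ^ 2) ^ (2 * j + 1) = q * q ^ (4 * j + 2) by ring,
      show q ^ (4 * j + 3) = q * q ^ (4 * j + 2) by ring]
    field_simp
    ring

lemma normRatio_mul_invPochNorm {q a : K} (hq : ∀ i : ℕ, 1 - q * q ^ i ≠ 0) (hq0 : q ≠ 0)
    (ha : 1 + a ≠ 0) (m : ℕ) :
    normRatio q a m * invPochNorm (q ^ 2) m q = ∏ i ∈ Icc 1 m, recLambda q a i := by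
  induction m with
  | zero =>
    rw [normRatio, coeff_gramBasis_even a 1 _ 0, coeff_gramBasis_even a q _ 0]
    simp [symProd, invPochNorm]
  | succ m ih =>
    rw [prod_Icc_succ_top (by omega), ← ih,
      invPochNorm_succ _ _ _ (one_sub_mul_sq_pow_ne_zero hq)]
    linear_combination invPochNorm (q ^ 2) m q * normRatio_succ_mul_invPochLambda hq hq0 ha m

lemma prod_range_prod_Icc (x : ℕ → K) (n : ℕ) :
    ∏ m ∈ range (n + 1), ∏ i ∈ Icc 1 m, x i = ∏ i ∈ Icc 1 n, x i ^ (n + 1 - i) := by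
  induction n with
  | zero => simp
  | succ n ih =>
    rw [prod_range_succ, ih, prod_Icc_succ_top (by omega), prod_Icc_succ_top (by omega),
      ← mul_assoc, ← prod_mul_distrib]
    congr 1
    · refine prod_congr rfl fun i hi => ?_
      rw [← pow_succ]
      congr 1
      have := (mem_Icc.1 hi).2
      omega
    · simp

/-- At `q = 0` the moments satisfy a linear recurrence of order two, so that the determinants of
size at least three vanish, in agreement with `λ_2 = 0`. -/
lemma det_P_zero (a : K) (ha : 1 + a ≠ 0) (n : ℕ) :
    Matrix.det (Matrix.of fun i j : Fin (n + 1) => P 0 a ((i : ℕ) + (j : ℕ))) =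
      ∏ i ∈ Icc 1 n, recLambda 0 a i ^ (n + 1 - i) := by
  have hq : ∀ i : ℕ, (1 : K) - 0 * 0 ^ i ≠ 0 := by simp
  have hP (m : ℕ) : P 0 a m = rogersSzego 0 a m := by
    simp [P_eq, invPoch, qPoch]
  have hrec (m : ℕ) : P 0 a (m + 2) = (1 + a) * P 0 a (m + 1) - a * P 0 a m := by
    rw [hP, hP, hP, rogersSzego_add_two hq]
    simp
  have h1 : P 0 a 1 = 1 + a := by
    rw [hP, rogersSzego, sum_range_succ, sum_range_one, qBinom_self hq, qBinom_zero_right hq]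
    ring
  match n with
  | 0 => simp [P_zero]
  | 1 =>
    rw [Matrix.det_fin_two]
    simp [recLambda, P_zero, hrec 0, h1]
    field_simp
    ring
  | n + 2 =>
    rw [prod_eq_zero (i := 2) (by simp)]
    · have hmod : 2 % (n + 2 + 1) = 2 := Nat.mod_eq_of_lt (by omega)
      -- The vector `(a, -(1 + a), 1, 0, …, 0)` encodes the recurrence and lies in the kernel.
      refine Matrix.exists_mulVec_eq_zero_iff.1
        ⟨Pi.single 2 1 - Pi.single 1 (1 + a) + Pi.single 0 a, fun h => ?_, ?_⟩
      · have h2 := congrFun h 2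
        have e1 : (2 : Fin (n + 3)) ≠ 1 := by simp [Fin.ext_iff, hmod]
        have e0 : (2 : Fin (n + 3)) ≠ 0 := by simp [Fin.ext_iff, hmod]
        simp [e1, e0] at h2
      · ext i
        rw [Matrix.mulVec_add, Matrix.mulVec_sub]
        have h2 := hrec i
        simp [hmod]
        linear_combination h2
    · simp [recLambda]

end QHermiteMoments

theorem mainTheorem4 {K : Type*} [Field K] (q a : K)
    (hq : ∀ m : ℕ, 1 ≤ m → q ^ m ≠ 1) (ha : 1 + a ≠ 0) (n : ℕ) :
    Matrix.det (Matrix.of fun i j : Fin (n + 1) =>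
        QHermiteMoments.P q a ((i : ℕ) + (j : ℕ))) =
      ∏ i ∈ Finset.Icc 1 n, QHermiteMoments.recLambda q a i ^ (n + 1 - i) := by
  have hq' (i : ℕ) : 1 - q * q ^ i ≠ 0 := by
    rw [← pow_succ', sub_ne_zero]
    exact (hq (i + 1) (by omega)).symm
  rcases eq_or_ne q 0 with rfl | hq0
  · exact QHermiteMoments.det_P_zero a ha n
  · rw [QHermiteMoments.det_P_eq_prod hq' hq0 ha, ← QHermiteMoments.prod_range_prod_Icc]
    exact Finset.prod_congr rfl fun m _ => QHermiteMoments.normRatio_mul_invPochNorm hq' hq0 ha m
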